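/- Let $G$ be a finite simple graph and let $K$ be a field. A matching of $G$ is a set of pairwise disjoint edges; it is an induced matching if no edge of $G$ meets two different edges of it. Let $m(G)$ and $im(G)$ be the largest cardinalities of a matching and of an induced matching of $G$. A star is a graph consisting of a vertex joined by an edge to each of $s \ge 0$ further vertices, with no other edges (so the graph with one vertex counts as a star); a star triangle is a graph consisting of $t \ge 1$ triangles sharing one common vertex and otherwise disjoint. The graph $G$ is called Cameron--Walker if it is connected, satisfies $im(G) = m(G)$, and is neither a star nor a star triangle. Let $S = K[V(G)]$ be the polynomial ring whose variables are the vertices of $G$, with the standard grading, and let $I(G) = (x_i x_j : \{x_i,x_j\} \in E(G)) \subset S$ be the edge ideal of $G$. With $d = \dim S/I(G)$ the Krull dimension, the Hilbert series of $S/I(G)$ is $\sum_{n \ge 0} \dim_K (S/I(G))_n \lambda^n = h(\lambda)/(1-\lambda)^d$ for a unique polynomial $h \in \mathbb{Z}[\lambda]$, the $h$-polynomial of $S/I(G)$, and $h \neq 0$; the $a$-invariant is $a(S/I(G)) = \deg h - d$. **Theorem.** If $G$ is a Cameron--Walker graph, then $a(K[V(G)]/I(G)) = 0$, i.e. the degree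 of the $h$-polynomial of $K[V(G)]/I(G)$ equals its Krull dimension. -/

import Mathlib

namespace CWGraph

open Polynomial

universe u v

section Graphs

variable {V : Type u}

/-- The matching number `m(G)`: the largest number of edges of a matching of `G`
(for finite `V` the set below is finite and contains `0`, so the supremum is a maximum). -/
noncomputable def matchingNumber (G : SimpleGraph V) : ℕ :=
  sSup {k : ℕ | ∃ M : G.Subgraph, M.IsMatching ∧ M.edgeSet.ncard = k}

/-- The induced matching number `im(G)`: the largest number of edges of an induced matching,
i.e. of a matching such that no edge of `G` meets two different edges of the matching. -/
noncomputable def inducedMatchingNumber (G : SimpleGraph V) : ℕ :=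
  sSup {k : ℕ | ∃ M : G.Subgraph, M.IsMatching ∧
    (∀ e ∈ M.edgeSet, ∀ e' ∈ M.edgeSet, e ≠ e' →
      ¬ ∃ f ∈ G.edgeSet, (∃ x, x ∈ e ∧ x ∈ f) ∧ (∃ y, y ∈ e' ∧ y ∈ f)) ∧
    M.edgeSet.ncard = k}

/-- `G` is a star: all other vertices are joined to a centre `r`, and there are no other edges.
The graph with a single vertex counts as a (degenerate) star. -/
def IsStar (G : SimpleGraph V) : Prop :=
  ∃ r : V, G = SimpleGraph.starGraph r

/-- `G` is a star triangle: a positive number of triangles glued at one common vertex `r`.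
That is, every other vertex is adjacent to `r` and to exactly one further vertex. -/
def IsStarTriangle (G : SimpleGraph V) : Prop :=
  Nontrivial V ∧ ∃ r : V, ∀ x : V, x ≠ r → G.Adj x r ∧ ∃! y : V, y ≠ r ∧ G.Adj x y

/-- A Cameron--Walker graph: a connected graph with `im(G) = m(G)` that is neither a star
nor a star triangle. (Finiteness of the vertex set is assumed where this is used.) -/
structure IsCameronWalker (G : SimpleGraph V) : Prop where
  connected : G.Connected
  inducedMatchingNumber_eq : inducedMatchingNumber G = matchingNumber G
  not_star : ¬ IsStar G
  not_starTriangle : ¬ IsStarTriangle G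

end Graphs

section Algebra

/-- The edge ideal `I(G) = (x_i x_j : {i, j} ∈ E(G))` in `K[V(G)]`. -/
noncomputable def edgeIdeal (K : Type v) [Field K] {V : Type u} (G : SimpleGraph V) :
    Ideal (MvPolynomial V K) :=
  Ideal.span {p | ∃ i j : V, G.Adj i j ∧ p = MvPolynomial.X i * MvPolynomial.X j}

variable {K : Type v} [Field K] {σ : Type u}

/-- The degree `n` part of `S/I`, where `S = K[σ]` is standard graded: the image of the space
of homogeneous polynomials of degree `n`. -/
noncomputable def gradedPiece (I : Ideal (MvPolynomial σ K)) (n : ℕ) :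
    Submodule K (MvPolynomial σ K ⧸ I) :=
  (MvPolynomial.homogeneousSubmodule σ K n).map (Ideal.Quotient.mkₐ K I).toLinearMap

/-- The Hilbert series `H(S/I, λ) = ∑ₙ dim_K (S/I)ₙ λⁿ`. -/
noncomputable def hilbertSeries (I : Ideal (MvPolynomial σ K)) : PowerSeries ℤ :=
  PowerSeries.mk fun n => (Module.finrank K (gradedPiece I n) : ℤ)

/-- `h` is the `h`-polynomial of `S/I`: `H(S/I, λ) * (1 - λ)^d = h(λ)` with `d = dim S/I`. -/
def IsHPolynomial (I : Ideal (MvPolynomial σ K)) (h : ℤ[X]) : Prop :=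
  ∃ d : ℕ, ringKrullDim (MvPolynomial σ K ⧸ I) = d ∧
    hilbertSeries I * (1 - PowerSeries.X) ^ d = (h : PowerSeries ℤ)

/-- The `h`-polynomial is unique. -/
theorem IsHPolynomial.unique {I : Ideal (MvPolynomial σ K)} {h h' : ℤ[X]}
    (H : IsHPolynomial I h) (H' : IsHPolynomial I h') : h = h' := by
  obtain ⟨d, hd, e⟩ := H
  obtain ⟨d', hd', e'⟩ := H'
  have hdd : d = d' := by
    rw [hd] at hd'
    exact_mod_cast hd'
  subst hdd
  exact Polynomial.coe_injective ℤ (e.symm.trans e')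

/-- `a` is the `a`-invariant of `S/I`: `S/I` has finite Krull dimension `d` and an
`h`-polynomial `h ≠ 0`, and `a = deg h - d`. -/
def HasAInvariant (I : Ideal (MvPolynomial σ K)) (a : ℤ) : Prop :=
  ∃ (h : ℤ[X]) (d : ℕ), IsHPolynomial I h ∧ h ≠ 0 ∧
    ringKrullDim (MvPolynomial σ K ⧸ I) = d ∧ a = (h.natDegree : ℤ) - (d : ℤ)

/-- The `a`-invariant is unique. -/
theorem HasAInvariant.unique {I : Ideal (MvPolynomial σ K)} {a a' : ℤ}
    (H : HasAInvariant I a) (H' : HasAInvariant I a') : a = a' := by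
  obtain ⟨h, d, hh, -, hd, rfl⟩ := H
  obtain ⟨h', d', hh', -, hd', rfl⟩ := H'
  have hdd : d = d' := by
    rw [hd] at hd'
    exact_mod_cast hd'
  rw [hh.unique hh', hdd]

end Algebra

end CWGraph

/-!
The `a`-invariant of `K[V] / I(G)` vanishes as soon as the independence polynomial of `G` does not
vanish at `-1`. For a Cameron–Walker graph its value there, the sum `∑ (-1) ^ #F` over the
independent sets `F`, is `±1`.

*Algebra.* The monomials with independent support form a basis of `K[V] / I(G)`, so its Hilbert
series is `∑ (λ / (1 - λ)) ^ #F`. The Krull dimension is the independence number `d` of `G`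
(`ringKrullDim_quotient_edgeIdeal`), whence `h = ∑ λ ^ #F * (1 - λ) ^ (d - #F)`. This polynomial has
degree at most `d`, and its coefficient at `λ ^ d` is `(-1) ^ d * ∑ (-1) ^ #F`
(`coeff_indepHPolynomial`).

*Graphs.* Since `im(G) = m(G)`, some induced matching is also a maximum matching. Having no
augmenting path, it forces the unmatched vertices to be pairwise non-adjacent and each matching edge
to be a pendant edge (its tip has no neighbour but its hub) or the base of a pendant triangle whose
apex is unmatched (`exists_hub_tip`). Because `G` is connected and is neither a star triangle nor a
single vertex, every unmatched vertex is adjacent to the hub of a pendant edge (`exists_adj_hub`).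

*Cancellation.* If a set `F` misses the hub of a pendant edge, adding or removing the tip keeps it
independent and changes the sign, so only the sets containing all these hubs matter. Such sets
contain no unmatched vertex, and then the same toggling works for the pendant triangles
(`sum_neg_one_pow_card_eq_sum_filter`). The only set left is the set of all hubs.
-/

namespace CWGraph

open Polynomial

/-! ### The Hilbert series of the edge ring -/

section HilbertSeries

open Finset

variable {V K : Type*} [Field K] (G : SimpleGraph V)

/-- `I(G)` is a monomial ideal: a polynomial lies in it iff the support of each of its monomials
contains an edge. -/
theorem mem_edgeIdeal_iff {p : MvPolynomial V K} :
    p ∈ edgeIdeal K G ↔ ∀ m ∈ p.support, ¬ G.IsIndepSet (m.support : Set V) := by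
  have hgen : {p : MvPolynomial V K | ∃ i j : V, G.Adj i j ∧
      p = MvPolynomial.X i * MvPolynomial.X j} =
      (fun s => MvPolynomial.monomial s (1 : K)) ''
        {s | ∃ i j : V, G.Adj i j ∧ s = Finsupp.single i 1 + Finsupp.single j 1} := by
    ext p
    constructor
    · rintro ⟨i, j, h, rfl⟩
      exact ⟨_, ⟨i, j, h, rfl⟩, by simp [MvPolynomial.X, MvPolynomial.monomial_mul]⟩
    · rintro ⟨_, ⟨i, j, h, rfl⟩, rfl⟩
      exact ⟨i, j, h, by simp [MvPolynomial.X, MvPolynomial.monomial_mul]⟩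
  rw [edgeIdeal, hgen, MvPolynomial.mem_ideal_span_monomial_image]
  refine forall₂_congr fun m _ => ?_
  constructor
  · rintro ⟨_, ⟨i, j, h, rfl⟩, hle⟩ hind
    have hi := hle i
    have hj := hle j
    simp only [Finsupp.add_apply, Finsupp.single_eq_same] at hi hj
    exact hind (by simp; omega) (by simp; omega) h.ne h
  · intro hind
    simp only [SimpleGraph.IsIndepSet, Set.Pairwise, not_forall, not_not] at hind
    obtain ⟨i, hi, j, hj, hij, h⟩ := hind
    refine ⟨_, ⟨i, j, h, rfl⟩, fun k => ?_⟩
    simp only [mem_coe, Finsupp.mem_support_iff] at hi hj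
    classical
    simp only [Finsupp.add_apply, Finsupp.single_apply]
    split_ifs <;> grind

variable [Fintype V] [DecidableEq V]

open Classical in
/-- The monomials of degree `n` whose support is an independent set form a basis of the degree `n`
part of `K[V] / I(G)`. -/
theorem finrank_gradedPiece_edgeIdeal (n : ℕ) :
    Module.finrank K (gradedPiece (edgeIdeal K G) n) =
      #{l ∈ finsuppAntidiag (univ : Finset V) n | G.IsIndepSet (l.support : Set V)} := by
  set B := {l ∈ finsuppAntidiag (univ : Finset V) n | G.IsIndepSet (l.support : Set V)} with hB
  let b : B → MvPolynomial V K ⧸ edgeIdeal K G :=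
    fun l => Ideal.Quotient.mkₐ K _ (MvPolynomial.monomial l.1 1)
  have hdeg : ∀ l : V →₀ ℕ, l ∈ B ↔ l.degree = n ∧ G.IsIndepSet (l.support : Set V) := by
    intro l
    simp [hB, Finsupp.degree_eq_sum]
  have hli : LinearIndependent K b := by
    rw [Fintype.linearIndependent_iff]
    intro g hg l
    have h1 : (∑ i : B, MvPolynomial.monomial i.1 (g i)) ∈ edgeIdeal K G := by
      rw [← Ideal.Quotient.eq_zero_iff_mem, ← hg, map_sum]
      refine sum_congr rfl fun i _ => ?_
      rw [← Ideal.Quotient.mkₐ_eq_mk K, ← map_smul]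
      simp [MvPolynomial.smul_monomial]
    rw [mem_edgeIdeal_iff] at h1
    by_contra hne
    refine h1 l.1 ?_ ((hdeg _).1 l.2).2
    rw [MvPolynomial.mem_support_iff, MvPolynomial.coeff_sum, sum_eq_single l]
    · simpa using hne
    · intro i _ hi
      rw [MvPolynomial.coeff_monomial, if_neg]
      exact fun h => hi (Subtype.ext h)
    · simp
  have hspan : gradedPiece (edgeIdeal K G) n = Submodule.span K (Set.range b) := by
    apply le_antisymm
    · rintro _ ⟨p, hp, rfl⟩
      rw [AlgHom.toLinearMap_apply, p.as_sum, map_sum]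
      refine Submodule.sum_mem _ fun m hm => ?_
      by_cases hind : G.IsIndepSet (m.support : Set V)
      · have hmn : m.degree = n := by
          have := hp (MvPolynomial.mem_support_iff.1 hm)
          rwa [Finsupp.degree_eq_weight_one]
        have : Ideal.Quotient.mkₐ K (edgeIdeal K G) (MvPolynomial.monomial m (p.coeff m)) =
            p.coeff m • b ⟨m, (hdeg m).2 ⟨hmn, hind⟩⟩ := by
          rw [← map_smul]
          simp [MvPolynomial.smul_monomial]
        rw [this]
        exact Submodule.smul_mem _ _ (Submodule.subset_span ⟨_, rfl⟩)
      · have : Ideal.Quotient.mkₐ K (edgeIdeal K G) (MvPolynomial.monomial m (p.coeff m)) = 0 := by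
          rw [Ideal.Quotient.mkₐ_eq_mk, Ideal.Quotient.eq_zero_iff_mem, mem_edgeIdeal_iff]
          intro m' hm'
          have := MvPolynomial.support_monomial_subset hm'
          rw [mem_singleton] at this
          rwa [this]
        rw [this]
        exact Submodule.zero_mem _
    · rw [Submodule.span_le]
      rintro _ ⟨l, rfl⟩
      refine ⟨MvPolynomial.monomial l.1 1, ?_, rfl⟩
      exact MvPolynomial.isHomogeneous_monomial _ ((hdeg _).1 l.2).1
  rw [hspan, finrank_span_eq_card hli, Fintype.card_coe]

/-- The independent sets of a finite graph. -/
noncomputable def indepFinsets : Finset (Finset V) :=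
  open Classical in {F : Finset V | G.IsIndepSet (F : Set V)}

variable {G} in
@[simp] theorem mem_indepFinsets {F : Finset V} :
    F ∈ indepFinsets G ↔ G.IsIndepSet (F : Set V) := by
  simp [indepFinsets]

/-- The monomials with support exactly `F` contribute `(λ / (1 - λ)) ^ #F`. -/
theorem coeff_X_mul_mk_one_pow_card (F : Finset V) (n : ℕ) :
    PowerSeries.coeff n ((PowerSeries.X * PowerSeries.mk 1 : PowerSeries ℤ) ^ #F) =
      #{l ∈ finsuppAntidiag (univ : Finset V) n | l.support = F} := by
  have hc : ∀ k : ℕ, PowerSeries.coeff k (PowerSeries.X * PowerSeries.mk 1 : PowerSeries ℤ) =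
      if k = 0 then 0 else 1 := by
    intro k
    cases k with
    | zero => simp
    | succ k => rw [mul_comm, PowerSeries.coeff_succ_mul_X]; simp
  rw [← prod_const, PowerSeries.coeff_prod, card_filter, Nat.cast_sum]
  have hsub : finsuppAntidiag F n ⊆ finsuppAntidiag (univ : Finset V) n :=
    finsuppAntidiag_mono (subset_univ F) n
  rw [← sum_subset hsub]
  · refine sum_congr rfl fun l hl => ?_
    rw [mem_finsuppAntidiag] at hl
    simp only [hc]
    split_ifs with h
    · refine (prod_eq_one fun i hi => ?_).trans (by simp)
      rw [← h, Finsupp.mem_support_iff] at hi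
      simp [hi]
    · obtain ⟨i, hi, hi'⟩ := exists_of_ssubset (hl.2.ssubset_of_ne h)
      rw [prod_eq_zero hi (by simpa using hi')]
      simp
  · intro l hl hl'
    rw [mem_finsuppAntidiag'] at hl hl'
    rw [if_neg, Nat.cast_zero]
    rintro rfl
    exact hl' ⟨hl.1, subset_rfl⟩

/-- The Hilbert series counts the monomials with independent support; they are sorted here by their
support. -/
theorem hilbertSeries_edgeIdeal :
    hilbertSeries (edgeIdeal K G) =
      ∑ F ∈ indepFinsets G, (PowerSeries.X * PowerSeries.mk 1 : PowerSeries ℤ) ^ #F := by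
  classical
  ext n
  rw [hilbertSeries, PowerSeries.coeff_mk, finrank_gradedPiece_edgeIdeal, map_sum]
  simp only [coeff_X_mul_mk_one_pow_card]
  rw [card_eq_sum_card_fiberwise (f := fun l : V →₀ ℕ => l.support) (t := indepFinsets G)]
  · push_cast
    refine sum_congr rfl fun F hF => ?_
    rw [filter_filter]
    congr 2
    ext l
    simp only [mem_filter, and_congr_right_iff, and_iff_right_iff_imp]
    rintro _ rfl
    simpa using hF
  · intro l hl
    simpa using (mem_filter.1 hl).2

/-- The `h`-polynomial of `K[V] / I(G)` in terms of the independent sets of `G`. No exponent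
is truncated, since `#F ≤ G.indepNum` for independent `F`. -/
noncomputable def indepHPolynomial : ℤ[X] :=
  ∑ F ∈ indepFinsets G, X ^ #F * (1 - X) ^ (G.indepNum - #F)

theorem hilbertSeries_edgeIdeal_mul :
    hilbertSeries (edgeIdeal K G) * (1 - PowerSeries.X) ^ G.indepNum =
      (indepHPolynomial G : PowerSeries ℤ) := by
  have hcoe : ((indepHPolynomial G : ℤ[X]) : PowerSeries ℤ) =
      ∑ F ∈ indepFinsets G, PowerSeries.X ^ #F *
        (1 - PowerSeries.X) ^ (G.indepNum - #F) := by
    rw [indepHPolynomial, ← Polynomial.coeToPowerSeries.ringHom_apply, map_sum]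
    simp
  rw [hcoe, hilbertSeries_edgeIdeal, sum_mul]
  refine sum_congr rfl fun F hF => ?_
  have hle : #F ≤ G.indepNum := (mem_indepFinsets.1 hF).card_le_indepNum
  have h1 : (1 - PowerSeries.X : PowerSeries ℤ) ^ G.indepNum =
      (1 - PowerSeries.X) ^ #F * (1 - PowerSeries.X) ^ (G.indepNum - #F) := by
    rw [← pow_add, Nat.add_sub_cancel' hle]
  rw [h1, ← mul_assoc, ← mul_pow, mul_assoc, PowerSeries.mk_one_mul_one_sub_eq_one, mul_one]

theorem natDegree_indepHPolynomial_le : (indepHPolynomial G).natDegree ≤ G.indepNum := by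
  refine natDegree_sum_le_of_forall_le _ _ fun F hF => ?_
  have hle : #F ≤ G.indepNum := (mem_indepFinsets.1 hF).card_le_indepNum
  have h1 : (1 - X : ℤ[X]).natDegree ≤ 1 := by
    refine (natDegree_sub_le _ _).trans ?_
    simp
  refine natDegree_mul_le.trans ?_
  have h2 := natDegree_pow_le_of_le (G.indepNum - #F) h1
  simp only [natDegree_X_pow]
  omega

/-- Up to sign, the top coefficient of the `h`-polynomial is the independence polynomial of `G`
evaluated at `-1`. -/
theorem coeff_indepHPolynomial :
    (indepHPolynomial G).coeff G.indepNum =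
      (-1) ^ G.indepNum * ∑ F ∈ indepFinsets G, (-1) ^ #F := by
  rw [indepHPolynomial, finsetSum_coeff, mul_sum]
  refine sum_congr rfl fun F hF => ?_
  obtain ⟨k, hk⟩ := Nat.exists_eq_add_of_le (mem_indepFinsets.1 hF).card_le_indepNum
  have h1 : (1 - X : ℤ[X]).natDegree ≤ 1 := by
    refine (natDegree_sub_le _ _).trans ?_
    simp
  have h2 : ((1 - X : ℤ[X]) ^ k).coeff k = (-1) ^ k := by
    have := coeff_pow_of_natDegree_le (m := k) h1
    simpa [coeff_one] using this
  rw [hk, Nat.add_sub_cancel_left, add_comm, coeff_X_pow_mul, h2, pow_add, mul_assoc, ← pow_add,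
    ← two_mul, pow_mul]
  simp

end HilbertSeries

/-! ### The Krull dimension of the edge ring -/

section KrullDimension

open Finset

/-- A chain of primes over `I` is a chain of primes over its smallest member. -/
theorem ringKrullDim_quotient_le_of_forall_isPrime {R : Type*} [CommRing R] {I : Ideal R}
    {n : WithBot ℕ∞}
    (h : ∀ P : Ideal R, P.IsPrime → I ≤ P → ringKrullDim (R ⧸ P) ≤ n) :
    ringKrullDim (R ⧸ I) ≤ n := by
  rw [ringKrullDim_quotient, Order.krullDim_eq_iSup_coheight]
  refine iSup_le fun p => ?_
  rw [Order.coheight_eq_krullDim_Ici]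
  refine le_trans ?_ (h p.1.asIdeal p.1.isPrime p.2)
  rw [ringKrullDim_quotient]
  exact Order.krullDim_le_of_strictMono (fun y => ⟨y.1.1, y.2⟩) fun _ _ hxy => hxy

variable {V K : Type*} [Field K] (G : SimpleGraph V) [Finite V]

/-- Modulo a prime ideal `P`, the variables in `P` vanish, and the remaining ones generate. -/
theorem ringKrullDim_quotient_le_card_notMem {P : Ideal (MvPolynomial V K)} :
    ringKrullDim (MvPolynomial V K ⧸ P) ≤ Nat.card {v : V // MvPolynomial.X v ∉ P} := by
  let φ : MvPolynomial {v : V // MvPolynomial.X v ∉ P} K →ₐ[K] MvPolynomial V K ⧸ P :=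
    MvPolynomial.aeval fun v => Ideal.Quotient.mkₐ K P (MvPolynomial.X v.1)
  have hφ : Function.Surjective φ := by
    intro y
    obtain ⟨p, rfl⟩ := Ideal.Quotient.mkₐ_surjective K P y
    induction p using MvPolynomial.induction_on with
    | C a => exact ⟨MvPolynomial.C a, by simp only [← MvPolynomial.algebraMap_eq, AlgHom.commutes]⟩
    | add p q hp hq =>
      obtain ⟨a, ha⟩ := hp
      obtain ⟨b, hb⟩ := hq
      exact ⟨a + b, by rw [map_add, map_add, ha, hb]⟩
    | mul_X p v hp =>
      obtain ⟨a, ha⟩ := hp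
      by_cases hv : MvPolynomial.X v ∈ P
      · refine ⟨0, ?_⟩
        have : Ideal.Quotient.mkₐ K P (MvPolynomial.X v) = 0 := by
          rwa [Ideal.Quotient.mkₐ_eq_mk, Ideal.Quotient.eq_zero_iff_mem]
        rw [map_mul, this, mul_zero, map_zero]
      · refine ⟨a * MvPolynomial.X ⟨v, hv⟩, ?_⟩
        rw [map_mul, map_mul, ha, MvPolynomial.aeval_X]
  have := ringKrullDim_le_of_surjective φ.toRingHom hφ
  rwa [MvPolynomial.ringKrullDim_of_isNoetherianRing, ringKrullDim_eq_zero_of_field,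
    zero_add] at this

/-- The Krull dimension of `K[V] / I(G)` is the independence number: the variables outside a prime
containing `I(G)` form an independent set, and conversely an independent set `F` gives a quotient
`K[F]`. -/
theorem ringKrullDim_quotient_edgeIdeal :
    ringKrullDim (MvPolynomial V K ⧸ edgeIdeal K G) = G.indepNum := by
  cases nonempty_fintype V
  classical
  apply le_antisymm
  · refine ringKrullDim_quotient_le_of_forall_isPrime fun P hP hle => ?_
    refine ringKrullDim_quotient_le_card_notMem.trans ?_
    have hind : G.IsIndepSet
        (({v : V | MvPolynomial.X v ∉ P} : Finset V) : Set V) := by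
      intro i hi j hj _ hij
      simp only [coe_filter, mem_univ, true_and, Set.mem_ofPred_eq] at hi hj
      have : MvPolynomial.X i * MvPolynomial.X j ∈ P :=
        hle (Ideal.subset_span ⟨i, j, hij, rfl⟩)
      exact (hP.mem_or_mem this).elim hi hj
    have := hind.card_le_indepNum
    rw [Nat.card_eq_fintype_card, Fintype.card_subtype]
    exact_mod_cast this
  · obtain ⟨F, hF⟩ := G.exists_isNIndepSet_indepNum
    have hinj : Function.Injective (Subtype.val : F → V) := Subtype.val_injective
    let ψ : MvPolynomial V K →ₐ[K] MvPolynomial F K := MvPolynomial.killCompl hinj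
    have hX : ∀ v, v ∉ F → ψ (MvPolynomial.X v) = 0 := by
      intro v hv
      simp [ψ, MvPolynomial.killCompl, hv]
    have hker : ∀ p ∈ edgeIdeal K G, ψ p = 0 := by
      intro p hp
      have : edgeIdeal K G ≤ RingHom.ker ψ := by
        refine Ideal.span_le.2 ?_
        rintro _ ⟨i, j, hij, rfl⟩
        change ψ _ = 0
        rw [map_mul]
        by_cases hi : i ∈ F
        · rw [hX j fun hj => hF.isIndepSet hi hj hij.ne hij, mul_zero]
        · rw [hX i hi, zero_mul]
      exact this hp
    have hsurj : Function.Surjective (Ideal.Quotient.lift (edgeIdeal K G) ψ.toRingHom hker) :=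
      Ideal.Quotient.lift_surjective_of_surjective _ _ fun q =>
        ⟨MvPolynomial.rename Subtype.val q, MvPolynomial.killCompl_rename_app hinj q⟩
    have := ringKrullDim_le_of_surjective _ hsurj
    rw [MvPolynomial.ringKrullDim_of_isNoetherianRing, ringKrullDim_eq_zero_of_field,
      zero_add] at this
    simpa [hF.card_eq] using this

/-- The `a`-invariant vanishes as soon as the independence polynomial does not vanish at `-1`. -/
theorem hasAInvariant_edgeIdeal_zero [Fintype V] [DecidableEq V]
    (h : ∑ F ∈ indepFinsets G, (-1 : ℤ) ^ #F ≠ 0) : HasAInvariant (edgeIdeal K G) 0 := by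
  have hcoeff : (indepHPolynomial G).coeff G.indepNum ≠ 0 := by
    rw [coeff_indepHPolynomial]
    exact mul_ne_zero (pow_ne_zero _ (by norm_num)) h
  refine ⟨indepHPolynomial G, G.indepNum,
    ⟨G.indepNum, ringKrullDim_quotient_edgeIdeal G, hilbertSeries_edgeIdeal_mul G⟩, ?_,
    ringKrullDim_quotient_edgeIdeal G, ?_⟩
  · intro h0
    rw [h0, coeff_zero] at hcoeff
    exact hcoeff rfl
  · rw [le_antisymm (natDegree_indepHPolynomial_le G) (le_natDegree_of_ne_zero hcoeff), sub_self]

end KrullDimension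

/-! ### Induced matchings that are maximum matchings -/

section MaximumInducedMatching

variable {V : Type*} {G : SimpleGraph V}

/-- A matching encoded by its edges: a set of edges of `G` no two of which share a vertex. In
contrast to subgraphs, such sets are easily changed edge by edge. -/
def IsEdgeMatching (G : SimpleGraph V) (E : Set (Sym2 V)) : Prop :=
  E ⊆ G.edgeSet ∧ ∀ e ∈ E, ∀ e' ∈ E, ∀ v, v ∈ e → v ∈ e' → e = e'

theorem bddAbove_ncard_matching [Finite V] (p : G.Subgraph → Prop) :
    BddAbove {k : ℕ | ∃ M : G.Subgraph, p M ∧ M.edgeSet.ncard = k} := by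
  refine ⟨Nat.card (Sym2 V), ?_⟩
  rintro _ ⟨M, -, rfl⟩
  exact Set.ncard_le_card _

theorem IsEdgeMatching.ncard_le_matchingNumber [Finite V] {E : Set (Sym2 V)}
    (hE : IsEdgeMatching G E) : E.ncard ≤ matchingNumber G := by
  let M : G.Subgraph :=
    { verts := {v | ∃ e ∈ E, v ∈ e}
      Adj := fun x y => s(x, y) ∈ E
      adj_sub := fun h => hE.1 h
      edge_vert := fun h => ⟨_, h, Sym2.mem_mk_left _ _⟩
      symm := ⟨fun x y h => by rwa [Sym2.eq_swap]⟩ }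
  have hM : M.IsMatching := by
    rintro v ⟨e, he, hv⟩
    obtain ⟨w, rfl⟩ := hv
    refine ⟨w, he, fun w' hw' => ?_⟩
    have := hE.2 _ he _ hw' v (Sym2.mem_mk_left _ _) (Sym2.mem_mk_left _ _)
    exact (Sym2.congr_right.1 this).symm
  have hedge : M.edgeSet = E := by
    ext e
    induction e with | _ x y => rfl
  exact le_csSup (bddAbove_ncard_matching _) ⟨M, hM, by rw [hedge]⟩

/-- An induced matching, given by its edges, that has maximum size among all matchings. -/
structure IsMaximumInducedMatching (G : SimpleGraph V) (E : Set (Sym2 V)) : Prop where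
  isEdgeMatching : IsEdgeMatching G E
  not_adj : ∀ e ∈ E, ∀ e' ∈ E, e ≠ e' → ∀ x ∈ e, ∀ y ∈ e', ¬ G.Adj x y
  ncard_le : ∀ E', IsEdgeMatching G E' → E'.ncard ≤ E.ncard

theorem exists_isMaximumInducedMatching [Finite V]
    (h : inducedMatchingNumber G = matchingNumber G) :
    ∃ E, IsMaximumInducedMatching G E := by
  have hmem : inducedMatchingNumber G ∈ {k : ℕ | ∃ M : G.Subgraph, M.IsMatching ∧
      (∀ e ∈ M.edgeSet, ∀ e' ∈ M.edgeSet, e ≠ e' →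
        ¬ ∃ f ∈ G.edgeSet, (∃ x, x ∈ e ∧ x ∈ f) ∧ (∃ y, y ∈ e' ∧ y ∈ f)) ∧
      M.edgeSet.ncard = k} := by
    refine Nat.sSup_mem ⟨0, ⊥, ?_, ?_, ?_⟩ ?_
    · intro v hv
      exact absurd hv (by simp)
    · simp
    · simp
    · simpa only [and_assoc] using bddAbove_ncard_matching (G := G) fun M => M.IsMatching ∧
        (∀ e ∈ M.edgeSet, ∀ e' ∈ M.edgeSet, e ≠ e' →
          ¬ ∃ f ∈ G.edgeSet, (∃ x, x ∈ e ∧ x ∈ f) ∧ (∃ y, y ∈ e' ∧ y ∈ f))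
  obtain ⟨M, hM, hind, hcard⟩ := hmem
  refine ⟨M.edgeSet, ⟨M.edgeSet_subset, ?_⟩, ?_, ?_⟩
  · rintro e he e' he' v ⟨w, rfl⟩ ⟨w', rfl⟩
    exact congrArg (fun x => s(v, x)) (hM.eq_of_adj_left he he')
  · intro e he e' he' hne x hx y hy hxy
    exact hind e he e' he' hne ⟨s(x, y), hxy, ⟨x, hx, Sym2.mem_mk_left _ _⟩,
      ⟨y, hy, Sym2.mem_mk_right _ _⟩⟩
  · intro E' hE'
    rw [hcard, h]
    exact hE'.ncard_le_matchingNumber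

variable {E : Set (Sym2 V)}

namespace IsMaximumInducedMatching

/-- Two adjacent unmatched vertices would enlarge the matching. -/
theorem not_adj_of_unmatched [Finite V] (hE : IsMaximumInducedMatching G E) {u v : V}
    (hu : ∀ e ∈ E, u ∉ e) (hv : ∀ e ∈ E, v ∉ e) : ¬ G.Adj u v := by
  intro huv
  have hnot : s(u, v) ∉ E := fun h => hu _ h (Sym2.mem_mk_left _ _)
  have hE' : IsEdgeMatching G (insert s(u, v) E) := by
    refine ⟨Set.insert_subset huv hE.isEdgeMatching.1, ?_⟩
    rintro e (rfl | he) e' (rfl | he') w hw hw'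
    · rfl
    · rcases Sym2.mem_iff.1 hw with rfl | rfl
      exacts [absurd hw' (hu _ he'), absurd hw' (hv _ he')]
    · rcases Sym2.mem_iff.1 hw' with rfl | rfl
      exacts [absurd hw (hu _ he), absurd hw (hv _ he)]
    · exact hE.isEdgeMatching.2 e he e' he' w hw hw'
  have := hE.ncard_le _ hE'
  rw [Set.ncard_insert_of_notMem hnot] at this
  omega

/-- If the ends `a`, `b` of a matching edge had distinct unmatched neighbours `u`, `v`, then
`u, a, b, v` would be an augmenting path. -/
theorem eq_of_adj_of_adj [Finite V] (hE : IsMaximumInducedMatching G E) {a b u v : V}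
    (hab : s(a, b) ∈ E) (hu : ∀ e ∈ E, u ∉ e) (hv : ∀ e ∈ E, v ∉ e)
    (hua : G.Adj u a) (hvb : G.Adj v b) : u = v := by
  by_contra hne
  have hd := hE.isEdgeMatching.2
  have hadj : G.Adj a b := hE.isEdgeMatching.1 hab
  have hub : u ≠ b := fun h => hu _ hab (h ▸ Sym2.mem_mk_right _ _)
  have hva : v ≠ a := fun h => hv _ hab (h ▸ Sym2.mem_mk_left _ _)
  have hdis : ∀ w, w ∈ s(u, a) → w ∉ s(v, b) := by
    have := hadj.ne
    intro w h1 h2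
    rw [Sym2.mem_iff] at h1 h2
    grind
  have h1 : ∀ e ∈ E \ {s(a, b)}, ∀ w ∈ s(u, a), w ∉ e := by
    rintro e ⟨he, hne'⟩ w hw hwe
    rcases Sym2.mem_iff.1 hw with rfl | rfl
    · exact hu _ he hwe
    · exact hne' (hd _ he _ hab _ hwe (Sym2.mem_mk_left _ _))
  have h2 : ∀ e ∈ E \ {s(a, b)}, ∀ w ∈ s(v, b), w ∉ e := by
    rintro e ⟨he, hne'⟩ w hw hwe
    rcases Sym2.mem_iff.1 hw with rfl | rfl
    · exact hv _ he hwe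
    · exact hne' (hd _ he _ hab _ hwe (Sym2.mem_mk_right _ _))
  have hn2 : s(v, b) ∉ E \ {s(a, b)} := fun h =>
    h2 _ h v (Sym2.mem_mk_left _ _) (Sym2.mem_mk_left _ _)
  have hn1 : s(u, a) ∉ insert s(v, b) (E \ {s(a, b)}) := by
    rintro (h | h)
    · exact hdis u (Sym2.mem_mk_left _ _) (h ▸ Sym2.mem_mk_left _ _)
    · exact h1 _ h u (Sym2.mem_mk_left _ _) (Sym2.mem_mk_left _ _)
  -- Exchange `ab` for `ua` and `vb`.
  have hE' : IsEdgeMatching G (insert s(u, a) (insert s(v, b) (E \ {s(a, b)}))) := by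
    refine ⟨Set.insert_subset hua (Set.insert_subset hvb
      (Set.sdiff_subset.trans hE.isEdgeMatching.1)), ?_⟩
    rintro e (rfl | rfl | he) e' (rfl | rfl | he') w hw hw'
    · rfl
    · exact absurd hw' (hdis w hw)
    · exact absurd hw' (h1 _ he' w hw)
    · exact absurd hw (hdis w hw')
    · rfl
    · exact absurd hw' (h2 _ he' w hw)
    · exact absurd hw (h1 _ he w hw')
    · exact absurd hw (h2 _ he w hw')
    · exact hd e he.1 e' he'.1 w hw hw'
  have := hE.ncard_le _ hE'
  rw [Set.ncard_insert_of_notMem hn1, Set.ncard_insert_of_notMem hn2] at this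
  have := Set.ncard_sdiff_singleton_add_one hab
  omega

theorem eq_or_unmatched_of_adj (hE : IsMaximumInducedMatching G E) {a b z : V}
    (hab : s(a, b) ∈ E) (haz : G.Adj a z) : z = b ∨ ∀ e ∈ E, z ∉ e := by
  by_contra! h
  obtain ⟨hne, e, he, hz⟩ := h
  by_cases hee : e = s(a, b)
  · subst hee
    rcases Sym2.mem_iff.1 hz with rfl | rfl
    exacts [haz.ne rfl, hne rfl]
  · exact hE.not_adj _ hab _ he (Ne.symm hee) a (Sym2.mem_mk_left _ _) z hz haz

/-- The ends of an edge of a triangle with unmatched apex `u` have no neighbours outside the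
triangle. -/
theorem eq_or_eq_of_adj [Finite V] (hE : IsMaximumInducedMatching G E) {a b u z : V}
    (hab : s(a, b) ∈ E) (hu : ∀ e ∈ E, u ∉ e) (hub : G.Adj u b) (haz : G.Adj a z) :
    z = b ∨ z = u := by
  rcases hE.eq_or_unmatched_of_adj hab haz with h | h
  · exact Or.inl h
  · exact Or.inr (hE.eq_of_adj_of_adj hab h hu haz.symm hub)

/-- Every edge of a maximum matching that is induced is either a pendant edge, attached at its
hub, or the base of a pendant triangle with unmatched apex. In the second case, the choice of the
hub is arbitrary. -/
theorem exists_hub_tip [Finite V] (hE : IsMaximumInducedMatching G E) :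
    ∃ hub tip : Sym2 V → V, ∀ e ∈ E, e = s(hub e, tip e) ∧
      ((∀ z, G.Adj (tip e) z → z = hub e) ∨
        ∃ u, (∀ e ∈ E, u ∉ e) ∧ G.Adj u (hub e) ∧ G.Adj u (tip e)) := by
  have key : ∀ e : Sym2 V, ∃ p : V × V, e ∈ E → e = s(p.1, p.2) ∧
      ((∀ z, G.Adj p.2 z → z = p.1) ∨
        ∃ u, (∀ e ∈ E, u ∉ e) ∧ G.Adj u p.1 ∧ G.Adj u p.2) := by
    intro e
    induction e with | _ a b
    by_cases hab : s(a, b) ∈ E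
    · have hba : s(b, a) ∈ E := by rwa [Sym2.eq_swap]
      by_cases hb : ∀ z, G.Adj b z → z = a
      · exact ⟨(a, b), fun _ => ⟨rfl, Or.inl hb⟩⟩
      by_cases ha : ∀ z, G.Adj a z → z = b
      · exact ⟨(b, a), fun _ => ⟨Sym2.eq_swap, Or.inl ha⟩⟩
      push Not at ha hb
      obtain ⟨u, hau, hub⟩ := ha
      obtain ⟨v, hbv, hva⟩ := hb
      have hu := (hE.eq_or_unmatched_of_adj hab hau).resolve_left hub
      have hv := (hE.eq_or_unmatched_of_adj hba hbv).resolve_left hva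
      obtain rfl := hE.eq_of_adj_of_adj hab hu hv hau.symm hbv.symm
      exact ⟨(a, b), fun _ => ⟨rfl, Or.inr ⟨u, hu, hau.symm, hbv.symm⟩⟩⟩
    · exact ⟨(a, b), fun h => absurd h hab⟩
  choose p hp using key
  exact ⟨fun e => (p e).1, fun e => (p e).2, hp⟩

/-- In a Cameron–Walker graph every unmatched vertex is adjacent to the hub of a pendant edge.
Otherwise the triangles with apex `u` form a connected component, so that the graph is a star
triangle or a single vertex. -/
theorem exists_adj_hub [Finite V] (hE : IsMaximumInducedMatching G E) (hG : IsCameronWalker G)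
    {hub tip : Sym2 V → V}
    (hht : ∀ e ∈ E, e = s(hub e, tip e) ∧
      ((∀ z, G.Adj (tip e) z → z = hub e) ∨
        ∃ u, (∀ e ∈ E, u ∉ e) ∧ G.Adj u (hub e) ∧ G.Adj u (tip e)))
    {u : V} (hu : ∀ e ∈ E, u ∉ e) :
    ∃ e ∈ E, (∀ z, G.Adj (tip e) z → z = hub e) ∧ G.Adj u (hub e) := by
  by_contra! hcon
  -- `C` consists of `u` and of the bases of the triangles with apex `u`.
  let C : Set V := {v | v = u ∨ ∃ w, s(v, w) ∈ E ∧ G.Adj u v ∧ G.Adj u w}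
  have hclosed : ∀ v w, v ∈ C → G.Adj v w → w ∈ C := by
    rintro v w (rfl | ⟨x, hx, huv, hux⟩) hvw
    · right
      have hw : ∃ e ∈ E, w ∈ e := by
        by_contra! h
        exact hE.not_adj_of_unmatched hu h hvw
      obtain ⟨e, he, hwe⟩ := hw
      obtain ⟨heq, h⟩ := hht e he
      have hwe' : w = hub e ∨ w = tip e := by
        rw [heq] at hwe
        exact Sym2.mem_iff.1 hwe
      have he' : s(hub e, tip e) ∈ E := heq ▸ he
      have he'' : s(tip e, hub e) ∈ E := by rwa [Sym2.eq_swap]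
      rcases h with h | ⟨x, hx, hxh, hxt⟩
      · rcases hwe' with rfl | rfl
        · exact absurd hvw (hcon e he h)
        · exact absurd (h v hvw.symm) fun h' => hu _ he' (h' ▸ Sym2.mem_mk_left _ _)
      · rcases hwe' with rfl | rfl
        · obtain rfl := hE.eq_of_adj_of_adj he' hu hx hvw hxt
          exact ⟨_, he', hvw, hxt⟩
        · obtain rfl := hE.eq_of_adj_of_adj he'' hu hx hvw hxh
          exact ⟨_, he'', hvw, hxh⟩
    · rcases hE.eq_or_eq_of_adj hx hu hux hvw with rfl | rfl
      · exact Or.inr ⟨v, by rwa [Sym2.eq_swap], hux, huv⟩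
      · exact Or.inl rfl
  have hall : ∀ v, v ∈ C := by
    intro v
    obtain ⟨p⟩ := hG.connected.preconnected u v
    have : ∀ x y, G.Walk x y → x ∈ C → y ∈ C := by
      intro x y p
      induction p with
      | nil => exact id
      | cons h _ ih => exact fun hx => ih (hclosed _ _ hx h)
    exact this u v p (Or.inl rfl)
  by_cases hV : Nontrivial V
  · refine hG.not_starTriangle ⟨hV, u, fun x hxu => ?_⟩
    obtain ⟨w, hxw, hux, huw⟩ := (hall x).resolve_left hxu
    refine ⟨hux.symm, w, ⟨huw.ne', hE.isEdgeMatching.1 hxw⟩, ?_⟩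
    rintro y ⟨hyu, hxy⟩
    exact (hE.eq_or_eq_of_adj hxw hu huw hxy).resolve_right hyu
  · rw [not_nontrivial_iff_subsingleton] at hV
    exact hG.not_star ⟨u, Subsingleton.elim _ _⟩

end IsMaximumInducedMatching

end MaximumInducedMatching

/-! ### The independence polynomial at `-1` -/

section AlternatingSum

open Finset

/-- If hubs and tips are disjoint and, for each `i`, the family `𝓕` is closed under adding and
removing the tip of `i` in sets avoiding the hub of `i`, then toggling tips cancels in the
alternating sum over `𝓕` all sets that do not contain every hub. -/
theorem sum_neg_one_pow_card_eq_sum_filter {ι V : Type*} [DecidableEq V]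
    (s : Finset ι) (hub tip : ι → V) (𝓕 : Finset (Finset V))
    (hne : ∀ i ∈ s, ∀ j ∈ s, tip i ≠ hub j)
    (hins : ∀ i ∈ s, ∀ F ∈ 𝓕, hub i ∉ F → insert (tip i) F ∈ 𝓕)
    (hers : ∀ i ∈ s, ∀ F ∈ 𝓕, hub i ∉ F → F.erase (tip i) ∈ 𝓕) :
    ∑ F ∈ 𝓕, (-1 : ℤ) ^ #F = ∑ F ∈ 𝓕 with s.image hub ⊆ F, (-1 : ℤ) ^ #F := by
  classical
  induction s using Finset.induction_on with
  | empty => simp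
  | insert i s _ ih =>
    rw [ih (fun i hi j hj => hne i (mem_insert_of_mem hi) j (mem_insert_of_mem hj))
      (fun i hi => hins i (mem_insert_of_mem hi)) (fun i hi => hers i (mem_insert_of_mem hi)),
      ← sum_filter_add_sum_filter_not _ (fun F => hub i ∈ F)]
    have hi := mem_insert_self i s
    -- Toggling the tip of `i` changes the sign and leaves the hubs alone.
    have hzero : ∑ F ∈ {F ∈ 𝓕 | s.image hub ⊆ F} with hub i ∉ F, (-1 : ℤ) ^ #F = 0 := by
      refine sum_involution
        (fun F _ => if tip i ∈ F then F.erase (tip i) else insert (tip i) F) ?_ ?_ ?_ ?_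
      · intro F _
        split_ifs with h
        · rw [← card_erase_add_one h, pow_succ]
          ring
        · rw [card_insert_of_notMem h, pow_succ]
          ring
      · intro F _ _
        split_ifs with h
        · exact fun h' => notMem_erase (tip i) F (h'.symm ▸ h)
        · exact fun h' => h (h' ▸ mem_insert_self _ _)
      · intro F hF
        simp only [mem_filter, image_subset_iff] at hF ⊢
        obtain ⟨⟨hF, hs⟩, hhub⟩ := hF
        split_ifs with h
        · refine ⟨⟨hers i hi F hF hhub, fun j hj => mem_erase.2 ⟨?_, hs j hj⟩⟩,
            fun h' => hhub (mem_of_mem_erase h')⟩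
          exact (hne i hi j (mem_insert_of_mem hj)).symm
        · refine ⟨⟨hins i hi F hF hhub, fun j hj => mem_insert_of_mem (hs j hj)⟩, fun h' => ?_⟩
          exact (mem_insert.1 h').elim (fun h' => hne i hi i hi h'.symm) hhub
      · intro F _
        by_cases h : tip i ∈ F
        · simp [h, insert_erase]
        · simp [h]
    rw [hzero, add_zero, filter_filter]
    congr 1
    ext F
    simp only [mem_filter, image_insert, insert_subset_iff]
    tauto

variable {V : Type*} [Fintype V] [DecidableEq V] {G : SimpleGraph V}

theorem insert_mem_indepFinsets {F : Finset V} {b : V} (hF : F ∈ indepFinsets G)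
    (hb : ∀ z ∈ F, ¬ G.Adj b z) : insert b F ∈ indepFinsets G := by
  rw [mem_indepFinsets] at hF ⊢
  rw [coe_insert]
  exact hF.insert fun z hz _ => ⟨hb z hz, fun h => hb z hz h.symm⟩

theorem erase_mem_indepFinsets {F : Finset V} (b : V) (hF : F ∈ indepFinsets G) :
    F.erase b ∈ indepFinsets G := by
  rw [mem_indepFinsets] at hF ⊢
  exact hF.mono (by simp)

/-- The independence polynomial of a Cameron–Walker graph does not vanish at `-1`: after
cancellation only the set of all hubs survives. -/
theorem IsCameronWalker.sum_neg_one_pow_card_ne_zero (hG : IsCameronWalker G) :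
    ∑ F ∈ indepFinsets G, (-1 : ℤ) ^ #F ≠ 0 := by
  classical
  obtain ⟨E, hE⟩ := exists_isMaximumInducedMatching hG.inducedMatchingNumber_eq
  obtain ⟨hub, tip, hht⟩ := hE.exists_hub_tip
  have hmem : ∀ e ∈ E, s(hub e, tip e) ∈ E := fun e he => (hht e he).1 ▸ he
  have hadj : ∀ e ∈ E, G.Adj (hub e) (tip e) := fun e he => hE.isEdgeMatching.1 (hmem e he)
  have hhub : ∀ e ∈ E, hub e ∈ e := fun e he =>
    Sym2.mem_iff_exists.2 ⟨tip e, (hht e he).1⟩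
  have htip : ∀ e ∈ E, tip e ∈ e := fun e he =>
    Sym2.mem_iff_exists.2 ⟨hub e, (hht e he).1.trans Sym2.eq_swap⟩
  have hne : ∀ e ∈ E, ∀ e' ∈ E, tip e ≠ hub e' := by
    intro e he e' he' h
    obtain rfl := hE.isEdgeMatching.2 e he e' he' _ (htip e he) (h ▸ hhub e' he')
    exact (hadj e he).ne h.symm
  -- `L` and `T` are the matching edges that are pendant and that lie in pendant triangles.
  let L : Finset (Sym2 V) := {e | e ∈ E ∧ ∀ z, G.Adj (tip e) z → z = hub e}
  let T : Finset (Sym2 V) := {e | e ∈ E ∧ ¬ ∀ z, G.Adj (tip e) z → z = hub e}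
  have hL : ∀ e, e ∈ L ↔ e ∈ E ∧ ∀ z, G.Adj (tip e) z → z = hub e := by simp [L]
  have hT : ∀ e, e ∈ T ↔ e ∈ E ∧ ¬ ∀ z, G.Adj (tip e) z → z = hub e := by simp [T]
  have hunm : ∀ F ∈ indepFinsets G, L.image hub ⊆ F → ∀ u ∈ F, ∃ e ∈ E, u ∈ e := by
    intro F hF hFL u huF
    by_contra! hu
    obtain ⟨e, he, hleaf, hadj⟩ := hE.exists_adj_hub hG hht hu
    exact mem_indepFinsets.1 hF huF (hFL (mem_image_of_mem _ ((hL e).2 ⟨he, hleaf⟩))) hadj.ne hadj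
  -- The order matters: the tip of an edge in `T` is also adjacent to the unmatched apex, which is
  -- excluded only once all the hubs of `L` are present.
  rw [sum_neg_one_pow_card_eq_sum_filter L hub tip _
      (fun e he e' he' => hne e ((hL e).1 he).1 e' ((hL e').1 he').1)
      (fun e he F hF hh => insert_mem_indepFinsets hF fun z hz hadj =>
        hh (((hL e).1 he).2 z hadj ▸ hz))
      (fun e _ F hF _ => erase_mem_indepFinsets _ hF),
    sum_neg_one_pow_card_eq_sum_filter T hub tip _
      (fun e he e' he' => hne e ((hT e).1 he).1 e' ((hT e').1 he').1)]
  rotate_left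
  · intro e he F hF hh
    obtain ⟨heE, hnl⟩ := (hT e).1 he
    obtain ⟨hF, hFL⟩ := mem_filter.1 hF
    refine mem_filter.2 ⟨insert_mem_indepFinsets hF fun z hz hadj => ?_,
      hFL.trans (subset_insert _ _)⟩
    obtain ⟨u, hu, huh, -⟩ := (hht e heE).2.resolve_left hnl
    have hmem' : s(tip e, hub e) ∈ E := by
      rw [Sym2.eq_swap]
      exact hmem e heE
    rcases hE.eq_or_eq_of_adj hmem' hu huh hadj with rfl | rfl
    · exact hh hz
    · obtain ⟨e', he', hze'⟩ := hunm F hF hFL z hz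
      exact hu e' he' hze'
  · intro e he F hF _
    obtain ⟨hF, hFL⟩ := mem_filter.1 hF
    refine mem_filter.2 ⟨erase_mem_indepFinsets _ hF, subset_erase.2 ⟨hFL, fun h => ?_⟩⟩
    obtain ⟨e', he', heq⟩ := mem_image.1 h
    exact hne e ((hT e).1 he).1 e' ((hL e').1 he').1 heq.symm
  have hsurv : {F ∈ {F ∈ indepFinsets G | L.image hub ⊆ F} | T.image hub ⊆ F} =
      {(L ∪ T).image hub} := by
    have hLT : ∀ e, e ∈ L ∪ T ↔ e ∈ E := by
      intro e
      rw [mem_union, hL, hT]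
      tauto
    ext F
    simp only [mem_filter, mem_singleton]
    constructor
    · rintro ⟨⟨hF, hFL⟩, hFT⟩
      have hFE : ∀ e ∈ E, hub e ∈ F := fun e he =>
        (mem_union.1 ((hLT e).2 he)).elim (fun h => hFL (mem_image_of_mem _ h))
          (fun h => hFT (mem_image_of_mem _ h))
      ext v
      simp only [mem_image, hLT]
      constructor
      · intro hv
        obtain ⟨e, he, hve⟩ := hunm F hF hFL v hv
        rw [(hht e he).1] at hve
        rcases Sym2.mem_iff.1 hve with rfl | rfl
        · exact ⟨e, he, rfl⟩
        · exact absurd (hadj e he)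
            (mem_indepFinsets.1 hF (hFE e he) hv (hadj e he).ne)
      · rintro ⟨e, he, rfl⟩
        exact hFE e he
    · rintro rfl
      refine ⟨⟨mem_indepFinsets.2 ?_, image_subset_image subset_union_left⟩,
        image_subset_image subset_union_right⟩
      intro x hx y hy hxy
      simp only [mem_coe, mem_image, hLT] at hx hy
      obtain ⟨e, he, rfl⟩ := hx
      obtain ⟨e', he', rfl⟩ := hy
      exact hE.not_adj e he e' he' (fun h => hxy (h ▸ rfl)) _ (hhub e he) _ (hhub e' he')
  rw [hsurv, sum_singleton]
  exact pow_ne_zero _ (by norm_num)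

end AlternatingSum

end CWGraph

theorem mainTheorem2 {V : Type*} [Finite V] (K : Type*) [Field K] (G : SimpleGraph V)
    (hG : CWGraph.IsCameronWalker G) :
    CWGraph.HasAInvariant (CWGraph.edgeIdeal K G) 0 := by
  classical
  cases nonempty_fintype V
  exact CWGraph.hasAInvariant_edgeIdeal_zero G hG.sum_neg_one_pow_card_ne_zero
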